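/- Let $U\subset\mathbb C$ and $\Omega\subset\mathbb C^n$ be bounded domains, and let $\varphi:U\times\Omega\to\mathbb R$ be a plurisubharmonic function that is smooth on $\overline{U\times\Omega}$. Write $\tau$ for the variable of $U$ and $z$ for the variable of $\Omega$. Let $g:U\to\mathbb R$ be a non-negative function such that $$\frac{\partial^2\varphi}{\partial\tau\,\partial\bar\tau}(\tau,z)-\left|\frac{\partial\varphi}{\partial\tau}(\tau,z)\right|^2\ \ge\ g(\tau)\qquad\text{for all }(\tau,z)\in U\times\Omega .$$ Define $\Phi,G:U\to\mathbb R$ by $$e^{-\Phi(\tau)}=\int_{\Omega}e^{-\varphi(\tau,z)}\,dz,\qquad G(\tau)=g(\tau)+\frac{\left|\int_{\Omega}\frac{\partial\varphi}{\partial\tau}(\tau,z)\,e^{-\varphi(\tau,z)}\,dz\right|^2}{\left(\int_{\Omega}e^{-\varphi(\tau,z)}\,dz\right)^2},$$ where the integrals are with respect to Lebesgue measure. For $a\in U$ let $\Delta(a;r)=\{\tau\in\mathbb C:|\tau-a|<r\}$ and $\delta(a)=\sup\{r>0:\Delta(a;r)\subset U\}$, and for $0<r<\delta(a)$ let $$L_\Phi(a,r)=\frac{1}{\pi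 r^2\,K_{\Delta(a;r),\Phi}(a)}$$ be the $L^2$-extension index of $\Phi$. Here $$K_{\Delta(a;r),\Phi}(a)=\sup\Big\{|f(a)|^2e^{-\Phi(a)}\ :\ f \text{ holomorphic on }\Delta(a;r),\ \int_{\Delta(a;r)}|f|^2e^{-\Phi}\le 1\Big\}$$ is the weighted Bergman kernel on the diagonal. Then for every $a\in U$ and every $\varepsilon>0$ there exists $r_\varepsilon\in(0,\delta(a))$ such that for all $r\in(0,r_\varepsilon)$ $$L_\Phi(a,r)\ \le\ e^{-\max\left\{\frac{G(a)-\varepsilon}{2},\,0\right\}r^2},$$ and moreover there is a holomorphic function $f_r$ on $\Delta(a;r)$ with $f_r(a)=1$ and $$\int_{\Delta(a;r)\times\Omega}|f_r(\tau)|^2e^{-\varphi(\tau,z)}\ \le\ e^{-\max\left\{\frac{G(a)-\varepsilon}{2},\,0\right\}r^2}\,\pi r^2\int_{\Omega}e^{-\varphi(a,z)}\,dz .$$ -/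

import Mathlib

open MeasureTheory Set Complex
open scoped ENNReal ContDiff

noncomputable section

namespace SharperEstimate

/-- The Wirtinger derivative `∂f/∂w = (∂f/∂x - i ∂f/∂y) / 2` of a function of one complex
variable `w = x + i y`. -/
def dW (f : ℂ → ℂ) (w : ℂ) : ℂ :=
  (fderiv ℝ f w 1 - I * fderiv ℝ f w I) / 2

/-- The Wirtinger derivative `∂f/∂w̄ = (∂f/∂x + i ∂f/∂y) / 2`. -/
def dWbar (f : ℂ → ℂ) (w : ℂ) : ℂ :=
  (fderiv ℝ f w 1 + I * fderiv ℝ f w I) / 2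

/-- `∂φ/∂τ (τ, z)` for a real function `φ` on `ℂ × ℂⁿ`. -/
def dTau {n : ℕ} (φ : ℂ × (Fin n → ℂ) → ℝ) (τ : ℂ) (z : Fin n → ℂ) : ℂ :=
  dW (fun t => (φ (t, z) : ℂ)) τ

/-- `∂²φ/∂τ∂τ̄ (τ, z)` for a real function `φ` on `ℂ × ℂⁿ`. Where `φ` is twice continuously
differentiable this number is real, so that taking its real part loses nothing. -/
def dTauTauBar {n : ℕ} (φ : ℂ × (Fin n → ℂ) → ℝ) (τ : ℂ) (z : Fin n → ℂ) : ℝ :=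
  (dW (dWbar (fun t => (φ (t, z) : ℂ))) τ).re

/-- A real-valued function `u` is plurisubharmonic on the open set `S`: it is upper semicontinuous
on `S`, and it satisfies the sub-mean value inequality on every closed disc
`{x + ζ v : |ζ| ≤ 1}` of a complex line that is contained in `S`. (The integrability clause says
that the circle mean is not `-∞`; it is part of the inequality, since `u x` is finite.) -/
def PlurisubharmonicOn {E : Type*} [NormedAddCommGroup E] [NormedSpace ℂ E]
    (u : E → ℝ) (S : Set E) : Prop :=
  UpperSemicontinuousOn u S ∧
    ∀ x v : E, (∀ ζ : ℂ, ‖ζ‖ ≤ 1 → x + ζ • v ∈ S) →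
      CircleIntegrable (fun ζ : ℂ => u (x + ζ • v)) 0 1 ∧
        u x ≤ Real.circleAverage (fun ζ : ℂ => u (x + ζ • v)) 0 1

/-- The squared norm `∫_D |f|² e^{-ψ}`, with value `∞` allowed. -/
def weightedNormSq (D : Set ℂ) (ψ : ℂ → ℝ) (f : ℂ → ℂ) : ℝ≥0∞ :=
  ∫⁻ w in D, ENNReal.ofReal (‖f w‖ ^ 2 * Real.exp (-ψ w))

/-- The weighted Bergman space `A²(D, ψ)` of holomorphic functions on `D` with
`∫_D |f|² e^{-ψ} < ∞`. -/
def weightedBergmanSpace (D : Set ℂ) (ψ : ℂ → ℝ) : Set (ℂ → ℂ) :=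
  {f | DifferentiableOn ℂ f D ∧ weightedNormSq D ψ f < ⊤}

/-- The weighted Bergman kernel on the diagonal, `K_{D,ψ}(a)`, that is the supremum of
`|f(a)|² e^{-ψ(a)}` over the unit ball of `A²(D, ψ)`. The weight `e^{-ψ(a)}` is part of the kernel
(the kernel is measured with respect to the metric `e^{-ψ}`). -/
def weightedBergmanKernel (D : Set ℂ) (ψ : ℂ → ℝ) (a : ℂ) : ℝ≥0∞ :=
  ⨆ f ∈ {f ∈ weightedBergmanSpace D ψ | weightedNormSq D ψ f ≤ 1},
    ENNReal.ofReal (‖f a‖ ^ 2 * Real.exp (-ψ a))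

/-- The `L²`-extension index `L_ψ(a, r) = 1 / (π r² K_{Δ(a;r),ψ}(a))`, where `Δ(a;r)` is the open
disc. -/
def extensionIndex (ψ : ℂ → ℝ) (a : ℂ) (r : ℝ) : ℝ≥0∞ :=
  (ENNReal.ofReal (Real.pi * r ^ 2) * weightedBergmanKernel (Metric.ball a r) ψ a)⁻¹

/-- `δ(a) = sup {r > 0 : Δ(a;r) ⊆ U}` (used for a bounded open `U` and `a ∈ U`). -/
def boundaryRadius (U : Set ℂ) (a : ℂ) : ℝ :=
  sSup {r : ℝ | 0 < r ∧ Metric.ball a r ⊆ U}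

/-- The function `Φ` with `e^{-Φ(τ)} = ∫_Ω e^{-φ(τ,z)}`. -/
def fiberPotential {n : ℕ} (φ : ℂ × (Fin n → ℂ) → ℝ) (Ω : Set (Fin n → ℂ)) (τ : ℂ) : ℝ :=
  -Real.log (∫ z in Ω, Real.exp (-φ (τ, z)))

/-- `G(τ) = g(τ) + |∫_Ω ∂φ/∂τ e^{-φ}|² / (∫_Ω e^{-φ})²`. -/
def curvatureBound {n : ℕ} (φ : ℂ × (Fin n → ℂ) → ℝ) (Ω : Set (Fin n → ℂ)) (g : ℂ → ℝ)
    (τ : ℂ) : ℝ :=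
  g τ + ‖∫ z in Ω, dTau φ τ z * (Real.exp (-φ (τ, z)) : ℂ)‖ ^ 2 /
    (∫ z in Ω, Real.exp (-φ (τ, z))) ^ 2

end SharperEstimate

end

/-!
The proof works with `V = e^{-φ}` and with its fibre integral `F(τ) = ∫_Ω V(τ, z) dz = e^{-Φ(τ)}`.
The curvature hypothesis says that the Laplacian of `V` in `τ` is at most `-4 g V`
(`laplacian_exp_neg`). For a holomorphic `f` on the disc, the integral of `|f|² e^{-φ}` over the
disc times `Ω` is the integral of `|f|² F` over the disc (`setIntegral_ball_prod`), and a competitor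
`f` with `f(a) = 1` bounds the extension index from above (`extensionIndex_le`). Hence both
conclusions follow from one explicit `f` with
`∫_{Δ(a;r)} |f|² F ≤ e^{-max((G(a) - ε)/2, 0) r²} π r² F(a)`.

If `G(a) ≤ ε`, take `f = 1`: since `g ≥ 0`, every `V(·, z)` is superharmonic, and the mean value
inequality `setIntegral_ball_le` can be integrated over `z`.

If `G(a) > ε`, take `f = 1 + α(τ - a)` with `α = -F_τ(a)/F(a)`. The mean of `|f|² F` over the four
points `a + iᵏ w` is at most `F(a)(1 - G(a)|w|²) + O(|w|³)` (`sum_four_rotations_le`): terms of odd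
order cancel, the Laplacian of `F` contributes `-g(a)`, and completing the square contributes
`-|F_τ(a)|²/F(a)²`. Integration over the disc gives
`π r² F(a)(1 - G(a) r²/2 + O(r³))`, and `1 - x ≤ e^{-x}` absorbs the error into `ε`. The remainder of
the Taylor expansion of `V(·, z)` is uniform in `z`, because `V` is smooth on the compact closure of
`U × Ω` and so has bounded derivatives (`exists_bound_norm_iteratedFDeriv`).
-/

section

-- the norm on spaces of iterated linear maps is not found at the default depth
set_option maxSynthPendingDepth 3

open Filter Topology

namespace SharperEstimate

/-! ### Uniform bounds and Taylor expansion -/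

/-- A function that is smooth up to the boundary of a relatively compact open set has bounded
derivatives there. Unique differentiability on the closure is not needed: near every point of the
closure some Taylor series witnesses the smoothness, and on the open set it is the actual one. -/
theorem exists_bound_norm_iteratedFDeriv {E F : Type*} [NormedAddCommGroup E] [NormedSpace ℝ E]
    [NormedAddCommGroup F] [NormedSpace ℝ F] {S : Set E} (hS : IsOpen S)
    (hc : IsCompact (closure S)) {f : E → F} {k : ℕ} (hf : ContDiffOn ℝ k f (closure S)) :
    ∃ M : ℝ, ∀ p ∈ S, ‖iteratedFDeriv ℝ k f p‖ ≤ M := by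
  have key : ∃ M : ℝ, ∀ p ∈ closure S ∩ S, ‖iteratedFDeriv ℝ k f p‖ ≤ M := by
    refine hc.induction_on (p := fun t => ∃ M : ℝ, ∀ p ∈ t ∩ S, ‖iteratedFDeriv ℝ k f p‖ ≤ M)
      ⟨0, by simp⟩ ?_ ?_ ?_
    · rintro s t hst ⟨M, hM⟩
      exact ⟨M, fun p hp => hM p ⟨hst hp.1, hp.2⟩⟩
    · rintro s t ⟨M, hM⟩ ⟨N, hN⟩
      refine ⟨max M N, ?_⟩
      rintro p ⟨hp | hp, hpS⟩
      · exact (hM p ⟨hp, hpS⟩).trans (le_max_left _ _)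
      · exact (hN p ⟨hp, hpS⟩).trans (le_max_right _ _)
    · intro x hx
      obtain ⟨u, hu, q, hq⟩ := contDiffWithinAt_nat.1 (hf x hx)
      rw [insert_eq_of_mem hx] at hu
      have hxu : x ∈ u := mem_of_mem_nhdsWithin hx hu
      have hcont : ContinuousWithinAt (fun y => ‖q y k‖) u x :=
        ((hq.cont k le_rfl) x hxu).norm
      have hev : ∀ᶠ y in 𝓝[u] x, ‖q y k‖ < ‖q x k‖ + 1 :=
        hcont.eventually_lt continuousWithinAt_const (lt_add_one _)
      obtain ⟨W, hWo, hxW, hW⟩ := mem_nhdsWithin.1 hev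
      obtain ⟨V, hVo, hxV, hV⟩ := mem_nhdsWithin.1 hu
      refine ⟨(V ∩ W) ∩ closure S, inter_mem
        (mem_nhdsWithin_of_mem_nhds ((hVo.inter hWo).mem_nhds ⟨hxV, hxW⟩)) self_mem_nhdsWithin,
        ‖q x k‖ + 1, ?_⟩
      rintro p ⟨⟨⟨hpV, hpW⟩, hpc⟩, hpS⟩
      have hsub : V ∩ S ⊆ u := fun y hy => hV ⟨hy.1, subset_closure hy.2⟩
      have ho : IsOpen (V ∩ S) := hVo.inter hS
      have heq : q p k = iteratedFDeriv ℝ k f p := by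
        rw [(hq.mono hsub).eq_iteratedFDerivWithin_of_uniqueDiffOn le_rfl ho.uniqueDiffOn
          ⟨hpV, hpS⟩, iteratedFDerivWithin_of_isOpen k ho ⟨hpV, hpS⟩]
      rw [← heq]
      exact (hW ⟨hpW, hV ⟨hpV, hpc⟩⟩).le
  obtain ⟨M, hM⟩ := key
  exact ⟨M, fun p hp => hM p ⟨subset_closure hp, hp⟩⟩

/-- Second order Taylor expansion, with a cubic remainder that is uniform in the base point. -/
theorem abs_taylor_two_remainder_le {E : Type*} [NormedAddCommGroup E] [NormedSpace ℝ E]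
    {S : Set E} (hS : IsOpen S) {f : E → ℝ} (hf : ContDiffOn ℝ 3 f S) {M : ℝ}
    (hM : ∀ p ∈ S, ‖iteratedFDeriv ℝ 3 f p‖ ≤ M) {x w : E} (hseg : segment ℝ x (x + w) ⊆ S) :
    |f (x + w) - f x - fderiv ℝ f x w - fderiv ℝ (fderiv ℝ f) x w w / 2| ≤ M * ‖w‖ ^ 3 := by
  have hf1 : ContDiffOn ℝ 2 (fderiv ℝ f) S := hf.fderiv_of_isOpen hS (by norm_num)
  have hf2 : ContDiffOn ℝ 1 (fderiv ℝ (fderiv ℝ f)) S := hf1.fderiv_of_isOpen hS (by norm_num)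
  have hd0 : ∀ y ∈ S, HasFDerivAt f (fderiv ℝ f y) y := fun y hy =>
    ((hf.contDiffAt (hS.mem_nhds hy)).differentiableAt (by norm_num)).hasFDerivAt
  have hd1 : ∀ y ∈ S, HasFDerivAt (fderiv ℝ f) (fderiv ℝ (fderiv ℝ f) y) y := fun y hy =>
    ((hf1.contDiffAt (hS.mem_nhds hy)).differentiableAt (by norm_num)).hasFDerivAt
  have hd2 : ∀ y ∈ S, HasFDerivAt (fderiv ℝ (fderiv ℝ f))
      (fderiv ℝ (fderiv ℝ (fderiv ℝ f)) y) y := fun y hy =>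
    ((hf2.contDiffAt (hS.mem_nhds hy)).differentiableAt (by norm_num)).hasFDerivAt
  have hM' : ∀ y ∈ S, ‖fderiv ℝ (fderiv ℝ (fderiv ℝ f)) y‖ ≤ M := by
    intro y hy
    have := hM y hy
    rwa [← norm_iteratedFDeriv_fderiv, ← norm_iteratedFDeriv_fderiv, norm_iteratedFDeriv_one]
      at this
  have hx : x ∈ segment ℝ x (x + w) := left_mem_segment _ _ _
  have hM0 : 0 ≤ M := (norm_nonneg _).trans (hM x (hseg hx))
  have hdist : ∀ y ∈ segment ℝ x (x + w), ‖y - x‖ ≤ ‖w‖ := by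
    intro y hy
    simpa using norm_sub_le_of_mem_segment hy
  have h2 : ∀ y ∈ segment ℝ x (x + w),
      ‖fderiv ℝ (fderiv ℝ f) y - fderiv ℝ (fderiv ℝ f) x‖ ≤ M * ‖w‖ := by
    intro y hy
    refine ((convex_segment x (x + w)).norm_image_sub_le_of_norm_hasFDerivWithin_le
      (fun p hp => (hd2 p (hseg hp)).hasFDerivWithinAt) (fun p hp => hM' p (hseg hp)) hx
      hy).trans ?_
    exact mul_le_mul_of_nonneg_left (hdist y hy) hM0
  have h1 : ∀ y ∈ segment ℝ x (x + w),
      ‖fderiv ℝ f y - fderiv ℝ f x - fderiv ℝ (fderiv ℝ f) x (y - x)‖ ≤ M * ‖w‖ * ‖w‖ := by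
    intro y hy
    refine ((convex_segment x (x + w)).norm_image_sub_le_of_norm_hasFDerivWithin_le'
      (fun p hp => (hd1 p (hseg hp)).hasFDerivWithinAt) h2 hx hy).trans ?_
    exact mul_le_mul_of_nonneg_left (hdist y hy) (by positivity)
  have hmem : ∀ t ∈ Icc (0 : ℝ) 1, x + t • w ∈ segment ℝ x (x + w) := by
    intro t ht
    rw [segment_eq_image']
    exact ⟨t, ht, by simp⟩
  have hder : ∀ t ∈ Icc (0 : ℝ) 1, HasDerivWithinAt
      (fun t : ℝ => f (x + t • w) - t * fderiv ℝ f x w - t ^ 2 / 2 * fderiv ℝ (fderiv ℝ f) x w w)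
      (fderiv ℝ f (x + t • w) w - fderiv ℝ f x w - t * fderiv ℝ (fderiv ℝ f) x w w)
      (Icc 0 1) t := by
    intro t ht
    have hline : HasDerivAt (fun t : ℝ => x + t • w) w t := by
      simpa using ((hasDerivAt_id t).smul_const w).const_add x
    have e1 := (hd0 _ (hseg (hmem t ht))).comp_hasDerivAt t hline
    have e2 := (hasDerivAt_id t).mul_const (fderiv ℝ f x w)
    have e3 := (((hasDerivAt_id t).pow 2).div_const 2).mul_const (fderiv ℝ (fderiv ℝ f) x w w)
    refine (((e1.sub e2).sub e3).congr_deriv ?_).hasDerivWithinAt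
    simp
  have hfin := (convex_Icc (0 : ℝ) 1).norm_image_sub_le_of_norm_hasDerivWithin_le
    (C := M * ‖w‖ ^ 3) hder (by
      intro t ht
      have hb := h1 _ (hmem t ht)
      have : fderiv ℝ f (x + t • w) w - fderiv ℝ f x w - t * fderiv ℝ (fderiv ℝ f) x w w
          = (fderiv ℝ f (x + t • w) - fderiv ℝ f x
              - fderiv ℝ (fderiv ℝ f) x (x + t • w - x)) w := by
        simp
      rw [this]
      refine (ContinuousLinearMap.le_opNorm _ _).trans ?_
      calc _ ≤ M * ‖w‖ * ‖w‖ * ‖w‖ := mul_le_mul_of_nonneg_right hb (norm_nonneg _)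
        _ = _ := by ring) (left_mem_Icc.2 zero_le_one) (right_mem_Icc.2 zero_le_one)
  simp only [one_smul, zero_smul, add_zero, sub_zero, norm_one, mul_one, Real.norm_eq_abs] at hfin
  refine le_trans (le_of_eq ?_) hfin
  congr 1
  ring

/-! ### The mean value inequality for superharmonic functions of class `C²` -/

/-- The sum of the second derivatives along `e` and `ie` is `‖e‖²` times the Laplacian. -/
theorem bilin_rotation_add (B : ℂ →L[ℝ] ℂ →L[ℝ] ℝ) (e : ℂ) :
    B e e + B (I * e) (I * e) = ‖e‖ ^ 2 * (B 1 1 + B I I) := by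
  have h1 : e = e.re • (1 : ℂ) + e.im • I := by
    apply Complex.ext <;> simp
  have h2 : I * e = (-e.im) • (1 : ℂ) + e.re • I := by
    apply Complex.ext <;> simp
  rw [h2, ← Complex.normSq_eq_norm_sq, Complex.normSq_apply]
  conv_lhs => rw [h1]
  simp only [map_add, map_smul, add_apply, smul_apply,
    smul_eq_mul, add_re, add_im, smul_re, smul_im, one_re, one_im, I_re, I_im]
  ring

/-- The radial derivative of a superharmonic function has nonpositive mean over circles. With
`e = w e^{iθ}`, the derivative in `s` of `s · Dv(a + s e)(e)` and the derivative in `θ` of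
`Dv(a + s e)(ie)` add up to `s ‖e‖²` times the Laplacian, and the second one integrates to zero over
the circle. -/
theorem intervalIntegral_radial_deriv_nonpos {v : ℂ → ℝ} {a : ℂ} {R : ℝ}
    (hv : ContDiffOn ℝ 2 v (Metric.ball a R))
    (hlap : ∀ p ∈ Metric.ball a R,
      fderiv ℝ (fderiv ℝ v) p 1 1 + fderiv ℝ (fderiv ℝ v) p I I ≤ 0)
    {w : ℂ} (hw : ‖w‖ < R) {t : ℝ} (ht : t ∈ Ioc (0 : ℝ) 1) :
    ∫ θ in (0 : ℝ)..(2 * Real.pi),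
      fderiv ℝ v (a + (t : ℂ) * (w * exp (θ * I))) (w * exp (θ * I)) ≤ 0 := by
  set e : ℝ → ℂ := fun θ => w * exp (θ * I) with he
  have hen : ∀ θ, ‖e θ‖ = ‖w‖ := fun θ => by simp [he]
  have hec : Continuous e := by fun_prop
  have hder_e : ∀ θ, HasDerivAt e (I * e θ) θ := by
    intro θ
    have h1 : HasDerivAt (fun θ : ℝ => (θ : ℂ) * I) I θ := by
      simpa using (Complex.ofRealCLM.hasDerivAt (x := θ)).mul_const I
    refine ((h1.cexp).const_mul w).congr_deriv ?_
    simp only [he]; ring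
  have hball : ∀ s ∈ Icc (0 : ℝ) 1, ∀ θ, a + (s : ℂ) * e θ ∈ Metric.ball a R := by
    intro s hs θ
    rw [mem_ball_iff_norm, add_sub_cancel_left, norm_mul, hen, Complex.norm_real,
      Real.norm_of_nonneg hs.1]
    exact (mul_le_of_le_one_left (norm_nonneg _) hs.2).trans_lt hw
  have hv1 : ContDiffOn ℝ 1 (fderiv ℝ v) (Metric.ball a R) :=
    hv.fderiv_of_isOpen Metric.isOpen_ball (by norm_num)
  have hc1 : ContinuousOn (fderiv ℝ v) (Metric.ball a R) := hv1.continuousOn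
  have hc2 : ContinuousOn (fderiv ℝ (fderiv ℝ v)) (Metric.ball a R) :=
    hv1.continuousOn_fderiv_of_isOpen Metric.isOpen_ball (by norm_num)
  have hd1 : ∀ p ∈ Metric.ball a R,
      HasFDerivAt (fderiv ℝ v) (fderiv ℝ (fderiv ℝ v) p) p := fun p hp =>
    ((hv1.contDiffAt (Metric.isOpen_ball.mem_nhds hp)).differentiableAt (by norm_num)).hasFDerivAt
  set D := fderiv ℝ v with hD
  set D2 := fderiv ℝ D with hD2
  have hmap : ContinuousOn (fun q : ℝ × ℝ => a + (q.1 : ℂ) * e q.2) (Icc 0 1 ×ˢ univ) := by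
    fun_prop
  have hmaps : MapsTo (fun q : ℝ × ℝ => a + (q.1 : ℂ) * e q.2) (Icc 0 1 ×ˢ univ)
      (Metric.ball a R) := fun q hq => hball q.1 hq.1 q.2
  have hC1 : ContinuousOn (fun q : ℝ × ℝ => D (a + (q.1 : ℂ) * e q.2)) (Icc 0 1 ×ˢ univ) :=
    hc1.comp hmap hmaps
  have hC2 : ContinuousOn (fun q : ℝ × ℝ => D2 (a + (q.1 : ℂ) * e q.2)) (Icc 0 1 ×ˢ univ) :=
    hc2.comp hmap hmaps
  have hecO : ContinuousOn (fun q : ℝ × ℝ => e q.2) (Icc 0 1 ×ˢ univ) := by fun_prop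
  -- the derivative of `s ↦ s · Dv(a + s e)(e)`
  set N : ℝ → ℝ → ℝ := fun s θ =>
    D (a + (s : ℂ) * e θ) (e θ) + s * D2 (a + (s : ℂ) * e θ) (e θ) (e θ) with hN
  have hNc : ContinuousOn (Function.uncurry N) (Icc 0 1 ×ˢ univ) := by
    have : ContinuousOn (fun q : ℝ × ℝ => q.1) (Icc 0 1 ×ˢ univ) := by fun_prop
    exact (hC1.clm_apply hecO).add (this.mul ((hC2.clm_apply hecO).clm_apply hecO))
  clear_value N D2 D
  have hsec : ∀ s ∈ Icc (0 : ℝ) 1, ∀ {g : ℝ × ℝ → ℝ}, ContinuousOn g (Icc 0 1 ×ˢ univ) →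
      Continuous fun θ => g (s, θ) := by
    intro s hs g hg
    rw [← continuousOn_univ]
    exact hg.comp (by fun_prop) (fun θ _ => ⟨hs, mem_univ _⟩)
  -- integrated over the circle, it is nonpositive
  have hinner : ∀ s ∈ Icc (0 : ℝ) 1, ∫ θ in (0 : ℝ)..(2 * Real.pi), N s θ ≤ 0 := by
    intro s hs
    have hT : ∀ θ : ℝ, HasDerivAt (fun θ => D (a + (s : ℂ) * e θ) (I * e θ))
        (s * D2 (a + (s : ℂ) * e θ) (I * e θ) (I * e θ) - D (a + (s : ℂ) * e θ) (e θ)) θ := by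
      intro θ
      have hl : HasDerivAt (fun θ => a + (s : ℂ) * e θ) ((s : ℂ) * (I * e θ)) θ :=
        ((hder_e θ).const_mul _).const_add _
      have h1 := (hd1 _ (hball s hs θ)).comp_hasDerivAt θ hl
      have h2 := (hder_e θ).const_mul I
      refine (h1.clm_apply h2).congr_deriv ?_
      have h3 : I * (I * e θ) = -(e θ) := by rw [← mul_assoc, I_mul_I]; ring
      have h4 : (s : ℂ) * (I * e θ) = s • (I * e θ) := by simp
      simp only [Function.comp_apply]
      rw [h3, h4, map_smul, map_neg]
      simp [sub_eq_add_neg]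
    have hIe : ContinuousOn (fun q : ℝ × ℝ => I * e q.2) (Icc 0 1 ×ˢ univ) := by fun_prop
    have hTc : Continuous fun θ : ℝ =>
        s * D2 (a + (s : ℂ) * e θ) (I * e θ) (I * e θ) - D (a + (s : ℂ) * e θ) (e θ) := by
      have k1 := hsec s hs ((hC2.clm_apply hIe).clm_apply hIe)
      have k2 := hsec s hs (hC1.clm_apply hecO)
      exact (continuous_const.mul k1).sub k2
    have hzero : ∫ θ in (0 : ℝ)..(2 * Real.pi),
        (s * D2 (a + (s : ℂ) * e θ) (I * e θ) (I * e θ) - D (a + (s : ℂ) * e θ) (e θ)) = 0 := by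
      rw [intervalIntegral.integral_eq_sub_of_hasDerivAt (fun θ _ => hT θ)
        (hTc.intervalIntegrable _ _)]
      have : e (2 * Real.pi) = e 0 := by
        simp [he]
      rw [this, sub_self]
    have hNs : Continuous (N s) := hsec s hs hNc
    have hsum : ∫ θ in (0 : ℝ)..(2 * Real.pi), N s θ
        = ∫ θ in (0 : ℝ)..(2 * Real.pi), (N s θ +
        (s * D2 (a + (s : ℂ) * e θ) (I * e θ) (I * e θ) - D (a + (s : ℂ) * e θ) (e θ))) := by
      rw [intervalIntegral.integral_add (hNs.intervalIntegrable _ _) (hTc.intervalIntegrable _ _),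
        hzero, add_zero]
    rw [hsum]
    have h2pi : (0 : ℝ) ≤ 2 * Real.pi := by positivity
    have hpt : ∀ θ, N s θ + (s * D2 (a + (s : ℂ) * e θ) (I * e θ) (I * e θ)
        - D (a + (s : ℂ) * e θ) (e θ)) ≤ 0 := by
      intro θ
      have hrot := bilin_rotation_add (D2 (a + (s : ℂ) * e θ)) (e θ)
      have hl := hlap _ (hball s hs θ)
      have : s * (‖e θ‖ ^ 2 * (D2 (a + (s : ℂ) * e θ) 1 1 + D2 (a + (s : ℂ) * e θ) I I)) ≤ 0 :=
        mul_nonpos_of_nonneg_of_nonpos hs.1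
          (mul_nonpos_of_nonneg_of_nonpos (by positivity) hl)
      rw [← hrot] at this
      simp only [hN]
      linarith
    rw [intervalIntegral.integral_of_le h2pi]
    exact setIntegral_nonpos measurableSet_Ioc fun θ _ => hpt θ
  -- so `t · Dv(a + t e)(e)`, integrated over the circle, is nonpositive as well
  have hFTC : ∀ θ, ∫ s in (0 : ℝ)..t, N s θ = t * D (a + (t : ℂ) * e θ) (e θ) := by
    intro θ
    have hsub : ∀ s ∈ uIcc 0 t, s ∈ Icc (0 : ℝ) 1 := by
      intro s hs
      rw [uIcc_of_le ht.1.le] at hs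
      exact ⟨hs.1, hs.2.trans ht.2⟩
    have hdd : ∀ s ∈ uIcc 0 t, HasDerivAt (fun s : ℝ => s * D (a + (s : ℂ) * e θ) (e θ))
        (N s θ) s := by
      intro s hs
      have hl : HasDerivAt (fun s : ℝ => a + (s : ℂ) * e θ) (e θ) s := by
        simpa using ((Complex.ofRealCLM.hasDerivAt (x := s)).mul_const (e θ)).const_add a
      have h1 : HasDerivAt (fun s : ℝ => D (a + (s : ℂ) * e θ))
          (D2 (a + (s : ℂ) * e θ) (e θ)) s :=
        (hd1 _ (hball s (hsub s hs) θ)).comp_hasDerivAt s hl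
      have h2 : HasDerivAt (fun s : ℝ => D (a + (s : ℂ) * e θ) (e θ))
          (D2 (a + (s : ℂ) * e θ) (e θ) (e θ)) s := by
        simpa using h1.clm_apply (hasDerivAt_const s (e θ))
      refine ((hasDerivAt_id s).mul h2).congr_deriv ?_
      simp [hN]
    have hci : ContinuousOn (fun s => N s θ) (uIcc 0 t) :=
      hNc.comp (f := fun s : ℝ => (s, θ)) (by fun_prop) (fun s hs => ⟨hsub s hs, mem_univ _⟩)
    rw [intervalIntegral.integral_eq_sub_of_hasDerivAt hdd hci.intervalIntegrable]
    simp
  have hswap : ∫ s in (0 : ℝ)..t, ∫ θ in (0 : ℝ)..(2 * Real.pi), N s θ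
      = ∫ θ in (0 : ℝ)..(2 * Real.pi), ∫ s in (0 : ℝ)..t, N s θ := by
    rw [intervalIntegral_intervalIntegral_swap]
    rw [uIoc_of_le ht.1.le, uIoc_of_le (by positivity)]
    have : IntegrableOn (Function.uncurry N) (Icc 0 t ×ˢ Icc 0 (2 * Real.pi)) :=
      (hNc.mono (prod_mono (Icc_subset_Icc_right ht.2) (subset_univ _))).integrableOn_compact
        (isCompact_Icc.prod isCompact_Icc)
    exact this.mono_set (prod_mono Ioc_subset_Icc_self Ioc_subset_Icc_self)
  have hle : ∫ s in (0 : ℝ)..t, ∫ θ in (0 : ℝ)..(2 * Real.pi), N s θ ≤ 0 := by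
    have : 0 ≤ ∫ s in (0 : ℝ)..t, -∫ θ in (0 : ℝ)..(2 * Real.pi), N s θ :=
      intervalIntegral.integral_nonneg ht.1.le (fun s hs =>
        neg_nonneg.2 (hinner s ⟨hs.1, hs.2.trans ht.2⟩))
    rw [intervalIntegral.integral_neg] at this
    linarith
  rw [hswap] at hle
  simp_rw [hFTC] at hle
  rw [intervalIntegral.integral_const_mul] at hle
  exact nonpos_of_mul_nonpos_right hle ht.1

/-- The mean of a `C²` superharmonic function over a circle is at most its value at the centre:
its derivative in the radius is nonpositive. -/
theorem intervalIntegral_circle_le {v : ℂ → ℝ} {a : ℂ} {R : ℝ}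
    (hv : ContDiffOn ℝ 2 v (Metric.ball a R))
    (hlap : ∀ p ∈ Metric.ball a R,
      fderiv ℝ (fderiv ℝ v) p 1 1 + fderiv ℝ (fderiv ℝ v) p I I ≤ 0)
    {w : ℂ} (hw : ‖w‖ < R) :
    ∫ θ in (0 : ℝ)..(2 * Real.pi), v (a + w * exp (θ * I)) ≤ 2 * Real.pi * v a := by
  set e : ℝ → ℂ := fun θ => w * exp (θ * I) with he
  have hen : ∀ θ, ‖e θ‖ = ‖w‖ := fun θ => by simp [he]
  have hec : Continuous e := by fun_prop
  have hball : ∀ s ∈ Icc (0 : ℝ) 1, ∀ θ, a + (s : ℂ) * e θ ∈ Metric.ball a R := by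
    intro s hs θ
    rw [mem_ball_iff_norm, add_sub_cancel_left, norm_mul, hen, Complex.norm_real,
      Real.norm_of_nonneg hs.1]
    exact (mul_le_of_le_one_left (norm_nonneg _) hs.2).trans_lt hw
  have hc1 : ContinuousOn (fderiv ℝ v) (Metric.ball a R) :=
    hv.continuousOn_fderiv_of_isOpen Metric.isOpen_ball (by norm_num)
  have hC1 : ContinuousOn (fun q : ℝ × ℝ => fderiv ℝ v (a + (q.1 : ℂ) * e q.2) (e q.2))
      (Icc 0 1 ×ˢ univ) :=
    (hc1.comp (f := fun q : ℝ × ℝ => a + (q.1 : ℂ) * e q.2) (by fun_prop)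
      (fun q hq => hball q.1 hq.1 q.2)).clm_apply (by fun_prop)
  have hFTC : ∀ θ, ∫ s in (0 : ℝ)..1, fderiv ℝ v (a + (s : ℂ) * e θ) (e θ)
      = v (a + e θ) - v a := by
    intro θ
    have hsub : uIcc (0 : ℝ) 1 = Icc 0 1 := uIcc_of_le zero_le_one
    have hdd : ∀ s ∈ uIcc (0 : ℝ) 1, HasDerivAt (fun s : ℝ => v (a + (s : ℂ) * e θ))
        (fderiv ℝ v (a + (s : ℂ) * e θ) (e θ)) s := by
      intro s hs
      rw [hsub] at hs
      have hl : HasDerivAt (fun s : ℝ => a + (s : ℂ) * e θ) (e θ) s := by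
        simpa using ((Complex.ofRealCLM.hasDerivAt (x := s)).mul_const (e θ)).const_add a
      exact (((hv.contDiffAt (Metric.isOpen_ball.mem_nhds (hball s hs θ))).differentiableAt
        (by norm_num)).hasFDerivAt).comp_hasDerivAt s hl
    have hci : ContinuousOn (fun s : ℝ => fderiv ℝ v (a + (s : ℂ) * e θ) (e θ)) (uIcc 0 1) :=
      hC1.comp (f := fun s : ℝ => (s, θ)) (by fun_prop)
        (fun s hs => ⟨by rwa [hsub] at hs, mem_univ _⟩)
    rw [intervalIntegral.integral_eq_sub_of_hasDerivAt hdd hci.intervalIntegrable]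
    simp
  have hswap : ∫ s in (0 : ℝ)..1, ∫ θ in (0 : ℝ)..(2 * Real.pi),
      fderiv ℝ v (a + (s : ℂ) * e θ) (e θ)
      = ∫ θ in (0 : ℝ)..(2 * Real.pi), ∫ s in (0 : ℝ)..1,
      fderiv ℝ v (a + (s : ℂ) * e θ) (e θ) := by
    rw [intervalIntegral_intervalIntegral_swap]
    rw [uIoc_of_le zero_le_one, uIoc_of_le (by positivity)]
    have : IntegrableOn (fun q : ℝ × ℝ => fderiv ℝ v (a + (q.1 : ℂ) * e q.2) (e q.2))
        (Icc 0 1 ×ˢ Icc 0 (2 * Real.pi)) :=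
      (hC1.mono (prod_mono le_rfl (subset_univ _))).integrableOn_compact
        (isCompact_Icc.prod isCompact_Icc)
    exact this.mono_set (prod_mono Ioc_subset_Icc_self Ioc_subset_Icc_self)
  have hle : ∫ s in (0 : ℝ)..1, ∫ θ in (0 : ℝ)..(2 * Real.pi),
      fderiv ℝ v (a + (s : ℂ) * e θ) (e θ) ≤ 0 := by
    rw [intervalIntegral.integral_of_le zero_le_one]
    exact setIntegral_nonpos measurableSet_Ioc fun s hs =>
      intervalIntegral_radial_deriv_nonpos hv hlap hw hs
  rw [hswap] at hle
  simp_rw [hFTC] at hle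
  have hvc : Continuous fun θ => v (a + e θ) := by
    rw [← continuousOn_univ]
    refine hv.continuousOn.comp (f := fun θ => a + e θ) (by fun_prop) (fun θ _ => ?_)
    simpa using hball 1 (right_mem_Icc.2 zero_le_one) θ
  rw [intervalIntegral.integral_sub (hvc.intervalIntegrable _ _)
    (continuous_const.intervalIntegrable _ _), intervalIntegral.integral_const] at hle
  simp only [sub_zero, smul_eq_mul] at hle
  linarith

theorem measurePreserving_add_mul (a : ℂ) {u : ℂ} (hu : ‖u‖ = 1) :
    MeasurePreserving (fun w : ℂ => a + u * w) volume volume ∧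
      MeasurableEmbedding (fun w : ℂ => a + u * w) := by
  obtain ⟨c, rfl⟩ : ∃ c : Circle, (c : ℂ) = u := ⟨⟨u, mem_sphere_zero_iff_norm.2 hu⟩, rfl⟩
  exact ⟨(measurePreserving_add_left (volume : Measure ℂ) a).comp (rotation c).measurePreserving,
    (measurableEmbedding_addLeft a).comp (rotation c).toHomeomorph.measurableEmbedding⟩

theorem preimage_add_mul_ball (a : ℂ) (r : ℝ) {u : ℂ} (hu : ‖u‖ = 1) :
    (fun w : ℂ => a + u * w) ⁻¹' Metric.ball a r = Metric.ball 0 r := by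
  ext w
  simp [hu]

theorem setIntegral_ball_rotate (a : ℂ) (r : ℝ) {u : ℂ} (hu : ‖u‖ = 1) (h : ℂ → ℝ) :
    ∫ w in Metric.ball a r, h w = ∫ w in Metric.ball (0 : ℂ) r, h (a + u * w) := by
  rw [← (measurePreserving_add_mul a hu).1.setIntegral_preimage_emb
    (measurePreserving_add_mul a hu).2, preimage_add_mul_ball a r hu]

theorem integrableOn_ball_rotate (a : ℂ) (r : ℝ) {u : ℂ} (hu : ‖u‖ = 1) {h : ℂ → ℝ}
    (hh : IntegrableOn h (Metric.ball a r)) :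
    IntegrableOn (fun w => h (a + u * w)) (Metric.ball 0 r) := by
  have := ((measurePreserving_add_mul a hu).1.integrableOn_comp_preimage
    (measurePreserving_add_mul a hu).2).2 hh
  rwa [preimage_add_mul_ball a r hu] at this

/-- **Mean value inequality**: the integral over a disc of a superharmonic function of class `C²` is
at most the area times the value at the centre. -/
theorem setIntegral_ball_le {v : ℂ → ℝ} {a : ℂ} {R : ℝ}
    (hv : ContDiffOn ℝ 2 v (Metric.ball a R))
    (hlap : ∀ p ∈ Metric.ball a R,
      fderiv ℝ (fderiv ℝ v) p 1 1 + fderiv ℝ (fderiv ℝ v) p I I ≤ 0)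
    {r : ℝ} (hr : 0 < r) (hrR : r < R) :
    ∫ w in Metric.ball a r, v w ≤ Real.pi * r ^ 2 * v a := by
  have h2pi : (0 : ℝ) < 2 * Real.pi := by positivity
  have hmem : ∀ θ : ℝ, ∀ w ∈ Metric.closedBall (0 : ℂ) r,
      a + exp (θ * I) * w ∈ Metric.ball a R := by
    intro θ w hw
    rw [mem_ball_iff_norm, add_sub_cancel_left, norm_mul, Complex.norm_exp_ofReal_mul_I, one_mul]
    exact (mem_closedBall_zero_iff.1 hw).trans_lt hrR
  have hc : ContinuousOn (Function.uncurry fun (θ : ℝ) (w : ℂ) => v (a + exp (θ * I) * w))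
      (Icc 0 (2 * Real.pi) ×ˢ Metric.closedBall (0 : ℂ) r) :=
    hv.continuousOn.comp (f := fun q : ℝ × ℂ => a + exp (q.1 * I) * q.2) (by fun_prop)
      (fun q hq => hmem q.1 q.2 hq.2)
  have hint : Integrable (Function.uncurry fun (θ : ℝ) (w : ℂ) => v (a + exp (θ * I) * w))
      ((volume.restrict (uIoc 0 (2 * Real.pi))).prod
        (volume.restrict (Metric.ball (0 : ℂ) r))) := by
    rw [Measure.prod_restrict, uIoc_of_le h2pi.le]
    exact (hc.integrableOn_compact (isCompact_Icc.prod (isCompact_closedBall _ _))).mono_set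
      (prod_mono Ioc_subset_Icc_self Metric.ball_subset_closedBall)
  have hrot : 2 * Real.pi * ∫ w in Metric.ball a r, v w
      = ∫ w in Metric.ball (0 : ℂ) r, ∫ θ in (0 : ℝ)..(2 * Real.pi), v (a + exp (θ * I) * w) := by
    rw [← intervalIntegral_integral_swap hint]
    simp_rw [← setIntegral_ball_rotate a r (Complex.norm_exp_ofReal_mul_I _)]
    simp
  have hle : ∫ w in Metric.ball (0 : ℂ) r, ∫ θ in (0 : ℝ)..(2 * Real.pi),
      v (a + exp (θ * I) * w) ≤ ∫ _ in Metric.ball (0 : ℂ) r, 2 * Real.pi * v a := by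
    refine setIntegral_mono_on ?_ (integrableOn_const measure_ball_lt_top.ne) measurableSet_ball ?_
    · have := hint.integral_prod_right
      simp only [intervalIntegral.intervalIntegral_eq_integral_uIoc, h2pi.le, if_true, one_smul]
      exact this
    · intro w hw
      have := intervalIntegral_circle_le hv hlap ((mem_ball_zero_iff.1 hw).trans hrR)
      simpa only [mul_comm w] using this
  rw [← hrot, setIntegral_const, smul_eq_mul, measureReal_def, Complex.volume_ball] at hle
  have hvol : (ENNReal.ofReal r ^ 2 * (NNReal.pi : ℝ≥0∞)).toReal = r ^ 2 * Real.pi := by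
    rw [ENNReal.toReal_mul, ENNReal.toReal_pow, ENNReal.toReal_ofReal hr.le,
      ENNReal.coe_toReal, NNReal.coe_real_pi]
  rw [hvol] at hle
  have : 2 * Real.pi * ∫ w in Metric.ball a r, v w ≤ 2 * Real.pi * (Real.pi * r ^ 2 * v a) := by
    linarith
  exact le_of_mul_le_mul_left this h2pi

/-- The second moment of a disc. -/
theorem setIntegral_ball_norm_sq {r : ℝ} (hr : 0 < r) :
    ∫ w in Metric.ball (0 : ℂ) r, ‖w‖ ^ 2 = Real.pi * r ^ 4 / 2 := by
  have h := integral_fun_norm_addHaar (volume : Measure ℂ) ((Iio r).indicator fun x : ℝ => x ^ 2)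
  have h1 : ∫ w : ℂ, (Iio r).indicator (fun x : ℝ => x ^ 2) ‖w‖
      = ∫ w in Metric.ball (0 : ℂ) r, ‖w‖ ^ 2 := by
    rw [← integral_indicator measurableSet_ball]
    congr 1 with w
    by_cases hw : ‖w‖ < r <;> simp [indicator, hw]
  have h2 : ∫ y in Ioi (0 : ℝ), y ^ (Module.finrank ℝ ℂ - 1) • (Iio r).indicator (fun x => x ^ 2) y
      = r ^ 4 / 4 := by
    have : ∀ y : ℝ, y ^ (Module.finrank ℝ ℂ - 1) • (Iio r).indicator (fun x => x ^ 2) y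
        = (Iio r).indicator (fun x => x ^ 3) y := by
      intro y
      by_cases hy : y < r
      · simp [indicator, hy, Complex.finrank_real_complex]; ring
      · simp [indicator, hy]
    simp_rw [this]
    rw [setIntegral_indicator measurableSet_Iio, Ioi_inter_Iio, ← integral_Ioc_eq_integral_Ioo,
      ← intervalIntegral.integral_of_le hr.le, integral_pow]
    norm_num
  rw [h1, h2] at h
  rw [h, measureReal_def, Complex.volume_ball, Complex.finrank_real_complex]
  simp
  ring

/-! ### Wirtinger derivatives and real derivatives -/

theorem fderiv_ofReal_comp {h : ℂ → ℝ} {t : ℂ} (hh : DifferentiableAt ℝ h t) (x : ℂ) :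
    fderiv ℝ (fun s => (h s : ℂ)) t x = (fderiv ℝ h t x : ℂ) := by
  have := (Complex.ofRealCLM.hasFDerivAt (x := h t)).comp t hh.hasFDerivAt
  rw [HasFDerivAt.fderiv (f := fun s => (h s : ℂ)) this]
  rfl

theorem dW_ofReal {h : ℂ → ℝ} {t : ℂ} (hh : DifferentiableAt ℝ h t) :
    dW (fun s => (h s : ℂ)) t = (fderiv ℝ h t 1 - I * fderiv ℝ h t I) / 2 := by
  rw [dW, fderiv_ofReal_comp hh, fderiv_ofReal_comp hh]

theorem norm_sq_dW_ofReal {h : ℂ → ℝ} {t : ℂ} (hh : DifferentiableAt ℝ h t) :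
    ‖dW (fun s => (h s : ℂ)) t‖ ^ 2 = (fderiv ℝ h t 1 ^ 2 + fderiv ℝ h t I ^ 2) / 4 := by
  rw [dW_ofReal hh, ← Complex.normSq_eq_norm_sq, Complex.normSq_div, Complex.normSq_apply]
  simp
  ring

/-- `∂²h/∂τ∂τ̄` is a quarter of the Laplacian. -/
theorem re_dW_dWbar_ofReal {h : ℂ → ℝ} {t : ℂ} (hh : ContDiffAt ℝ 2 h t) :
    (dW (dWbar (fun s => (h s : ℂ))) t).re
      = (fderiv ℝ (fderiv ℝ h) t 1 1 + fderiv ℝ (fderiv ℝ h) t I I) / 4 := by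
  have hev : dWbar (fun s => (h s : ℂ)) =ᶠ[𝓝 t]
      fun s => ((fderiv ℝ h s 1 : ℂ) + I * (fderiv ℝ h s I : ℂ)) / 2 := by
    filter_upwards [hh.eventually (by simp)] with s hs
    have hd : DifferentiableAt ℝ h s := hs.differentiableAt (by norm_num)
    rw [dWbar, fderiv_ofReal_comp hd, fderiv_ofReal_comp hd]
  have hd : HasFDerivAt (fderiv ℝ h) (fderiv ℝ (fderiv ℝ h) t) t :=
    ((hh.fderiv_right (m := 1) (by norm_num)).differentiableAt (by norm_num)).hasFDerivAt
  have hx : ∀ x : ℂ, HasFDerivAt (fun s => (fderiv ℝ h s x : ℂ))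
      (Complex.ofRealCLM.comp ((ContinuousLinearMap.apply ℝ ℝ x).comp
        (fderiv ℝ (fderiv ℝ h) t))) t := fun x =>
    (Complex.ofRealCLM.hasFDerivAt).comp t
      (((ContinuousLinearMap.apply ℝ ℝ x).hasFDerivAt).comp t hd)
  have hD := ((hx 1).add ((hx I).const_mul I)).mul_const (2⁻¹ : ℂ)
  have hfd := hev.fderiv_eq (𝕜 := ℝ)
  simp only [div_eq_mul_inv] at hfd
  rw [dW, hfd.trans hD.fderiv]
  simp
  ring

/-- The first and second derivatives of `e^{-h}`. -/
theorem fderiv_exp_neg {h : ℂ → ℝ} {t : ℂ} (hh : DifferentiableAt ℝ h t) :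
    fderiv ℝ (fun s => Real.exp (-h s)) t = -(Real.exp (-h t) • fderiv ℝ h t) := by
  refine (hh.hasFDerivAt.neg.exp).fderiv.trans ?_
  simp

theorem fderiv_fderiv_exp_neg {h : ℂ → ℝ} {t : ℂ} (hh : ContDiffAt ℝ 2 h t) (x y : ℂ) :
    fderiv ℝ (fderiv ℝ fun s => Real.exp (-h s)) t x y
      = Real.exp (-h t) * (fderiv ℝ h t x * fderiv ℝ h t y - fderiv ℝ (fderiv ℝ h) t x y) := by
  have hev : fderiv ℝ (fun s => Real.exp (-h s)) =ᶠ[𝓝 t]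
      fun s => -(Real.exp (-h s) • fderiv ℝ h s) := by
    filter_upwards [hh.eventually (by simp)] with s hs
    exact fderiv_exp_neg (hs.differentiableAt (by norm_num))
  have hd0 : DifferentiableAt ℝ h t := hh.differentiableAt (by norm_num)
  have hd : HasFDerivAt (fderiv ℝ h) (fderiv ℝ (fderiv ℝ h) t) t :=
    ((hh.fderiv_right (m := 1) (by norm_num)).differentiableAt (by norm_num)).hasFDerivAt
  have hD := ((hd0.hasFDerivAt.neg.exp).smul hd).neg
  rw [hev.fderiv_eq.trans hD.fderiv]
  simp
  ring

/-- The Laplacian of `e^{-h}`, in terms of the Wirtinger derivatives of `h`. -/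
theorem laplacian_exp_neg {h : ℂ → ℝ} {t : ℂ} (hh : ContDiffAt ℝ 2 h t) :
    fderiv ℝ (fderiv ℝ fun s => Real.exp (-h s)) t 1 1
      + fderiv ℝ (fderiv ℝ fun s => Real.exp (-h s)) t I I
      = 4 * Real.exp (-h t) * (‖dW (fun s => (h s : ℂ)) t‖ ^ 2
        - (dW (dWbar (fun s => (h s : ℂ))) t).re) := by
  rw [fderiv_fderiv_exp_neg hh, fderiv_fderiv_exp_neg hh,
    norm_sq_dW_ofReal (hh.differentiableAt (by norm_num)), re_dW_dWbar_ofReal hh]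
  ring

theorem fderiv_slice {E : Type*} [NormedAddCommGroup E] [NormedSpace ℝ E] {V : ℂ × E → ℝ} {t : ℂ}
    {z : E} (hV : DifferentiableAt ℝ V (t, z)) :
    fderiv ℝ (fun s => V (s, z)) t
      = (fderiv ℝ V (t, z)).comp (ContinuousLinearMap.inl ℝ ℂ E) := by
  have h1 : HasFDerivAt (fun s : ℂ => (s, z)) (ContinuousLinearMap.inl ℝ ℂ E) t :=
    hasFDerivAt_prodMk_left t z
  exact (hV.hasFDerivAt.comp t h1).fderiv

theorem fderiv_fderiv_slice {E : Type*} [NormedAddCommGroup E] [NormedSpace ℝ E] {V : ℂ × E → ℝ}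
    {t : ℂ} {z : E} (hV : ContDiffAt ℝ 2 V (t, z)) (x y : ℂ) :
    fderiv ℝ (fderiv ℝ (fun s => V (s, z))) t x y
      = fderiv ℝ (fderiv ℝ V) (t, z) (x, 0) (y, 0) := by
  have h1 : HasFDerivAt (fun s : ℂ => (s, z)) (ContinuousLinearMap.inl ℝ ℂ E) t :=
    hasFDerivAt_prodMk_left t z
  have hev : fderiv ℝ (fun s => V (s, z)) =ᶠ[𝓝 t]
      fun s => (fderiv ℝ V (s, z)).comp (ContinuousLinearMap.inl ℝ ℂ E) := by
    filter_upwards [h1.continuousAt.eventually (hV.eventually (by simp))] with s hs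
    exact fderiv_slice (hs.differentiableAt (by norm_num))
  have hd : HasFDerivAt (fderiv ℝ V) (fderiv ℝ (fderiv ℝ V) (t, z)) (t, z) :=
    ((hV.fderiv_right (m := 1) (by norm_num)).differentiableAt (by norm_num)).hasFDerivAt
  have hD := (hd.comp t h1).clm_comp (hasFDerivAt_const (ContinuousLinearMap.inl ℝ ℂ E) t)
  rw [hev.fderiv_eq.trans hD.fderiv]
  simp

/-! ### Averages against `|1 + α(w - a)|²` -/

/-- Averaging over the four rotations of `w` by powers of `i` removes the terms of odd order and
leaves the traces of the quadratic ones. The factor `|1 + αw|²` is chosen to cancel the linear term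
of `F`. -/
theorem sum_four_rotations_le {F : ℂ → ℝ} {a α : ℂ} {F₀ A B C M g R : ℝ} (hF₀ : 0 < F₀)
    (hM : 0 ≤ M) (hg : 0 ≤ g) (hlap : A + C ≤ -4 * g * F₀)
    (hF : ∀ w : ℂ, ‖w‖ < R → F (a + w) ≤ F₀ - 2 * F₀ * (α * w).re
      + (A * w.re ^ 2 + B * w.re * w.im + C * w.im ^ 2) / 2 + M * ‖w‖ ^ 3)
    {w : ℂ} (hw : ‖w‖ < R) (hw1 : ‖w‖ ≤ 1) :
    ‖1 + α * (1 * w)‖ ^ 2 * F (a + 1 * w) + ‖1 + α * (I * w)‖ ^ 2 * F (a + I * w)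
      + ‖1 + α * (-1 * w)‖ ^ 2 * F (a + -1 * w) + ‖1 + α * (-I * w)‖ ^ 2 * F (a + -I * w)
      ≤ 4 * F₀ - 4 * F₀ * (g + ‖α‖ ^ 2) * ‖w‖ ^ 2 + 4 * ((1 + ‖α‖) ^ 2 * M) * ‖w‖ ^ 3 := by
  have hone : ∀ u : ℂ, ‖u‖ = 1 → ‖1 + α * (u * w)‖ ^ 2 * F (a + u * w)
      ≤ ‖1 + α * (u * w)‖ ^ 2 * (F₀ - 2 * F₀ * (α * (u * w)).re
        + (A * (u * w).re ^ 2 + B * (u * w).re * (u * w).im + C * (u * w).im ^ 2) / 2)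
        + ((1 + ‖α‖) ^ 2 * M) * ‖w‖ ^ 3 := by
    intro u hu
    have hn : ‖u * w‖ = ‖w‖ := by rw [norm_mul, hu, one_mul]
    have h1 := mul_le_mul_of_nonneg_left (hF (u * w) (by rwa [hn]))
      (sq_nonneg ‖1 + α * (u * w)‖)
    rw [hn] at h1
    have h2 : ‖1 + α * (u * w)‖ ≤ 1 + ‖α‖ := by
      refine (norm_add_le _ _).trans ?_
      rw [norm_one, norm_mul, hn]
      have := mul_le_of_le_one_right (norm_nonneg α) hw1
      linarith
    have h3 : ‖1 + α * (u * w)‖ ^ 2 ≤ (1 + ‖α‖) ^ 2 := pow_le_pow_left₀ (norm_nonneg _) h2 2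
    have h4 := mul_le_mul_of_nonneg_right h3 (mul_nonneg hM (pow_nonneg (norm_nonneg w) 3))
    linarith
  have e1 := hone 1 norm_one
  have e2 := hone I Complex.norm_I
  have e3 := hone (-1) (by simp)
  have e4 := hone (-I) (by simp)
  have hquart : ‖α‖ ^ 2 * ‖w‖ ^ 4 * (A + C) ≤ 0 :=
    mul_nonpos_of_nonneg_of_nonpos (by positivity)
      (hlap.trans (by nlinarith [mul_nonneg hg hF₀.le]))
  have hquad : ‖w‖ ^ 2 * (A + C) ≤ ‖w‖ ^ 2 * (-4 * g * F₀) :=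
    mul_le_mul_of_nonneg_left hlap (by positivity)
  have h4 : ‖w‖ ^ 4 = (‖w‖ ^ 2) ^ 2 := by ring
  rw [h4] at hquart
  refine (add_le_add (add_le_add (add_le_add e1 e2) e3) e4).trans ?_
  have key : ‖1 + α * (1 * w)‖ ^ 2 * (F₀ - 2 * F₀ * (α * (1 * w)).re
        + (A * (1 * w).re ^ 2 + B * (1 * w).re * (1 * w).im + C * (1 * w).im ^ 2) / 2)
      + ‖1 + α * (I * w)‖ ^ 2 * (F₀ - 2 * F₀ * (α * (I * w)).re
        + (A * (I * w).re ^ 2 + B * (I * w).re * (I * w).im + C * (I * w).im ^ 2) / 2)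
      + ‖1 + α * (-1 * w)‖ ^ 2 * (F₀ - 2 * F₀ * (α * (-1 * w)).re
        + (A * (-1 * w).re ^ 2 + B * (-1 * w).re * (-1 * w).im + C * (-1 * w).im ^ 2) / 2)
      + ‖1 + α * (-I * w)‖ ^ 2 * (F₀ - 2 * F₀ * (α * (-I * w)).re
        + (A * (-I * w).re ^ 2 + B * (-I * w).re * (-I * w).im + C * (-I * w).im ^ 2) / 2)
      = 4 * F₀ + ‖w‖ ^ 2 * (A + C) - 4 * F₀ * ‖α‖ ^ 2 * ‖w‖ ^ 2
        + ‖α‖ ^ 2 * (‖w‖ ^ 2) ^ 2 * (A + C) := by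
    simp only [← Complex.normSq_eq_norm_sq, Complex.normSq_apply]
    simp
    ring
  linarith

/-- Integration of `sum_four_rotations_le` over a disc. -/
theorem setIntegral_ball_mul_le {F : ℂ → ℝ} {a α : ℂ} {F₀ A B C M g R : ℝ} (hF₀ : 0 < F₀)
    (hM : 0 ≤ M) (hg : 0 ≤ g) (hlap : A + C ≤ -4 * g * F₀)
    (hF : ∀ w : ℂ, ‖w‖ < R → F (a + w) ≤ F₀ - 2 * F₀ * (α * w).re
      + (A * w.re ^ 2 + B * w.re * w.im + C * w.im ^ 2) / 2 + M * ‖w‖ ^ 3)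
    {r : ℝ} (hr : 0 < r) (hrR : r < R) (hr1 : r ≤ 1)
    (hint : IntegrableOn (fun w => ‖1 + α * (w - a)‖ ^ 2 * F w) (Metric.ball a r)) :
    ∫ w in Metric.ball a r, ‖1 + α * (w - a)‖ ^ 2 * F w
      ≤ F₀ * (Real.pi * r ^ 2) * (1 - (g + ‖α‖ ^ 2) / 2 * r ^ 2)
        + (1 + ‖α‖) ^ 2 * M * r ^ 3 * (Real.pi * r ^ 2) := by
  set H : ℂ → ℝ := fun w => ‖1 + α * (w - a)‖ ^ 2 * F w with hH
  have hHu : ∀ u w : ℂ, H (a + u * w) = ‖1 + α * (u * w)‖ ^ 2 * F (a + u * w) := by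
    intro u w; simp [hH]
  have i1 := integrableOn_ball_rotate a r norm_one hint
  have i2 := integrableOn_ball_rotate a r Complex.norm_I hint
  have i3 := integrableOn_ball_rotate a r (u := -1) (by simp) hint
  have i4 := integrableOn_ball_rotate a r (u := -I) (by simp) hint
  have i12 : IntegrableOn (fun w => H (a + 1 * w) + H (a + I * w)) (Metric.ball 0 r) := i1.add i2
  have i123 : IntegrableOn (fun w => H (a + 1 * w) + H (a + I * w) + H (a + -1 * w))
      (Metric.ball 0 r) := i12.add i3
  have hsum : 4 * ∫ w in Metric.ball a r, H w
      = ∫ w in Metric.ball (0 : ℂ) r,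
        (H (a + 1 * w) + H (a + I * w) + H (a + -1 * w) + H (a + -I * w)) := by
    rw [integral_add i123 i4, integral_add i12 i3, integral_add i1 i2,
      ← setIntegral_ball_rotate a r norm_one, ← setIntegral_ball_rotate a r Complex.norm_I,
      ← setIntegral_ball_rotate a r (u := -1) (by simp),
      ← setIntegral_ball_rotate a r (u := -I) (by simp)]
    ring
  have ibd : IntegrableOn (fun w : ℂ => ‖w‖ ^ 2) (Metric.ball 0 r) :=
    ((by fun_prop : Continuous fun w : ℂ => ‖w‖ ^ 2).continuousOn.integrableOn_compact
      (isCompact_closedBall 0 r)).mono_set Metric.ball_subset_closedBall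
  have ic : ∀ c : ℝ, IntegrableOn (fun _ : ℂ => c) (Metric.ball 0 r) := fun c =>
    integrableOn_const measure_ball_lt_top.ne
  have hle : 4 * ∫ w in Metric.ball a r, H w ≤ ∫ w in Metric.ball (0 : ℂ) r,
      ((4 * F₀ + 4 * ((1 + ‖α‖) ^ 2 * M) * r ^ 3) - 4 * F₀ * (g + ‖α‖ ^ 2) * ‖w‖ ^ 2) := by
    rw [hsum]
    refine setIntegral_mono_on (i123.add i4) ((ic _).sub (ibd.const_mul _))
      measurableSet_ball ?_
    intro w hw
    have hw' : ‖w‖ < r := mem_ball_zero_iff.1 hw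
    have := sum_four_rotations_le hF₀ hM hg hlap hF (hw'.trans hrR) (hw'.le.trans hr1)
    simp only [hHu]
    have h3 : 4 * ((1 + ‖α‖) ^ 2 * M) * ‖w‖ ^ 3 ≤ 4 * ((1 + ‖α‖) ^ 2 * M) * r ^ 3 :=
      mul_le_mul_of_nonneg_left (pow_le_pow_left₀ (norm_nonneg _) hw'.le 3) (by positivity)
    linarith
  rw [integral_sub (ic _) (ibd.const_mul _), integral_const_mul, setIntegral_ball_norm_sq hr,
    setIntegral_const, smul_eq_mul, measureReal_def, Complex.volume_ball, ENNReal.toReal_mul,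
    ENNReal.toReal_pow, ENNReal.toReal_ofReal hr.le, ENNReal.coe_toReal, NNReal.coe_real_pi] at hle
  linarith

/-! ### The extension index -/

/-- A single holomorphic competitor bounds the extension index from above. -/
theorem extensionIndex_le {ψ : ℂ → ℝ} {a : ℂ} {r c : ℝ} (hr : 0 < r) (hc : 0 < c) {f : ℂ → ℂ}
    (hf : DifferentiableOn ℂ f (Metric.ball a r)) (hfa : f a = 1)
    (hint : IntegrableOn (fun w => ‖f w‖ ^ 2 * Real.exp (-ψ w)) (Metric.ball a r))
    (hle : ∫ w in Metric.ball a r, ‖f w‖ ^ 2 * Real.exp (-ψ w)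
      ≤ c * (Real.pi * r ^ 2) * Real.exp (-ψ a)) :
    extensionIndex ψ a r ≤ ENNReal.ofReal c := by
  set B := c * (Real.pi * r ^ 2) * Real.exp (-ψ a) with hB
  have hBpos : 0 < B := by positivity
  set f' : ℂ → ℂ := fun w => ((Real.sqrt B)⁻¹ : ℝ) * f w with hf'
  have hnorm : ∀ w, ‖f' w‖ ^ 2 = B⁻¹ * ‖f w‖ ^ 2 := by
    intro w
    rw [hf', norm_mul, Complex.norm_real, mul_pow, norm_inv,
      Real.norm_of_nonneg (Real.sqrt_nonneg _), inv_pow, Real.sq_sqrt hBpos.le]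
  have hw : weightedNormSq (Metric.ball a r) ψ f' ≤ 1 := by
    have h1 : weightedNormSq (Metric.ball a r) ψ f'
        = ENNReal.ofReal (B⁻¹ * ∫ w in Metric.ball a r, ‖f w‖ ^ 2 * Real.exp (-ψ w)) := by
      rw [weightedNormSq, ← integral_const_mul,
        ofReal_integral_eq_lintegral_ofReal (hint.const_mul _)
          (Eventually.of_forall fun w => by positivity)]
      simp_rw [hnorm, mul_assoc]
    rw [h1]
    refine ENNReal.ofReal_le_one.2 ?_
    calc _ ≤ B⁻¹ * B := mul_le_mul_of_nonneg_left hle (by positivity)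
      _ = 1 := inv_mul_cancel₀ hBpos.ne'
  have hK : ENNReal.ofReal (‖f' a‖ ^ 2 * Real.exp (-ψ a))
      ≤ weightedBergmanKernel (Metric.ball a r) ψ a :=
    le_iSup₂_of_le (f := fun f (_ : f ∈ {f ∈ weightedBergmanSpace (Metric.ball a r) ψ |
      weightedNormSq (Metric.ball a r) ψ f ≤ 1}) => ENNReal.ofReal (‖f a‖ ^ 2 * Real.exp (-ψ a)))
      f' ⟨⟨hf.const_mul _, hw.trans_lt ENNReal.one_lt_top⟩, hw⟩ le_rfl
  rw [hnorm, hfa, norm_one, one_pow, mul_one] at hK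
  rw [extensionIndex, ENNReal.inv_le_iff_inv_le, ← ENNReal.ofReal_inv_of_pos hc]
  calc ENNReal.ofReal c⁻¹
      = ENNReal.ofReal (Real.pi * r ^ 2) * ENNReal.ofReal (B⁻¹ * Real.exp (-ψ a)) := by
        rw [← ENNReal.ofReal_mul (by positivity)]
        congr 1
        have := Real.exp_pos (-ψ a)
        have := Real.pi_pos
        rw [hB]
        field_simp
    _ ≤ _ := mul_le_mul_right hK _

/-! ### Integration along the fibres -/

theorem integrableOn_of_continuousOn_of_bounded {X : Type*} [TopologicalSpace X]
    [MeasurableSpace X] [OpensMeasurableSpace X] {μ : Measure X} {s : Set X} (hs : MeasurableSet s)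
    (hμ : μ s ≠ ⊤) {h : X → ℝ} (hc : ContinuousOn h s) {M : ℝ} (hM : ∀ p ∈ s, ‖h p‖ ≤ M) :
    IntegrableOn h s μ := by
  have : IsFiniteMeasure (μ.restrict s) := ⟨by simpa using hμ.lt_top⟩
  exact Integrable.of_bound (hc.aestronglyMeasurable hs) (C := M) (ae_restrict_of_forall_mem hs hM)

section Fibre

variable {n : ℕ} {U : Set ℂ} {Ω : Set (Fin n → ℂ)} {V : ℂ × (Fin n → ℂ) → ℝ}

/-- Taylor expansion of the fibre integral `τ ↦ ∫_Ω V(τ, z)` at `a`: the expansions of the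
functions `V(·, z)` are integrated, their remainders being uniform in `z`. No differentiation under
the integral sign is involved. -/
theorem fibreIntegral_taylor_le (hU : IsOpen U) (hΩ : IsOpen Ω) (hvol : volume Ω ≠ ⊤)
    (hV : ContDiffOn ℝ 3 V (U ×ˢ Ω))
    (hb : ∀ k ≤ 3, ∃ M : ℝ, ∀ p ∈ U ×ˢ Ω, ‖iteratedFDeriv ℝ k V p‖ ≤ M) {a : ℂ} {R : ℝ}
    (hR : 0 < R) (haR : Metric.ball a R ⊆ U) :
    (∀ x, IntegrableOn (fun z => fderiv ℝ V (a, z) x) Ω) ∧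
    (∀ x y, IntegrableOn (fun z => fderiv ℝ (fderiv ℝ V) (a, z) x y) Ω) ∧
    ∃ M : ℝ, 0 ≤ M ∧ ∀ w : ℂ, ‖w‖ < R → ∫ z in Ω, V (a + w, z) ≤ (∫ z in Ω, V (a, z))
      + ((∫ z in Ω, fderiv ℝ V (a, z) (1, 0)) * w.re
        + (∫ z in Ω, fderiv ℝ V (a, z) (I, 0)) * w.im)
      + ((∫ z in Ω, fderiv ℝ (fderiv ℝ V) (a, z) (1, 0) (1, 0)) * w.re ^ 2
        + ((∫ z in Ω, fderiv ℝ (fderiv ℝ V) (a, z) (1, 0) (I, 0))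
          + (∫ z in Ω, fderiv ℝ (fderiv ℝ V) (a, z) (I, 0) (1, 0))) * w.re * w.im
        + (∫ z in Ω, fderiv ℝ (fderiv ℝ V) (a, z) (I, 0) (I, 0)) * w.im ^ 2) / 2
      + M * ‖w‖ ^ 3 := by
  have hS : IsOpen (U ×ˢ Ω) := hU.prod hΩ
  have ha : a ∈ U := haR (Metric.mem_ball_self hR)
  have hV1 : ContDiffOn ℝ 2 (fderiv ℝ V) (U ×ˢ Ω) := hV.fderiv_of_isOpen hS (by norm_num)
  have hc2 : ContinuousOn (fderiv ℝ (fderiv ℝ V)) (U ×ˢ Ω) :=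
    hV1.continuousOn_fderiv_of_isOpen hS (by norm_num)
  have hslice : ∀ τ ∈ U, MapsTo (fun z : Fin n → ℂ => (τ, z)) Ω (U ×ˢ Ω) :=
    fun τ hτ z hz => ⟨hτ, hz⟩
  have hsc : ∀ τ : ℂ, ContinuousOn (fun z : Fin n → ℂ => (τ, z)) Ω := fun τ => by fun_prop
  obtain ⟨M0, hM0⟩ := hb 0 (by norm_num)
  obtain ⟨M1, hM1⟩ := hb 1 (by norm_num)
  obtain ⟨M2, hM2⟩ := hb 2 (by norm_num)
  obtain ⟨M3, hM3⟩ := hb 3 le_rfl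
  have hi0 : ∀ τ ∈ U, IntegrableOn (fun z => V (τ, z)) Ω := fun τ hτ =>
    integrableOn_of_continuousOn_of_bounded hΩ.measurableSet hvol
      (hV.continuousOn.comp (hsc τ) (hslice τ hτ)) (M := M0)
      (fun z hz => by simpa using hM0 (τ, z) ⟨hτ, hz⟩)
  have hi1 : ∀ x, IntegrableOn (fun z => fderiv ℝ V (a, z) x) Ω := fun x =>
    integrableOn_of_continuousOn_of_bounded hΩ.measurableSet hvol
      ((hV1.continuousOn.comp (hsc a) (hslice a ha)).clm_apply continuousOn_const) (M := M1 * ‖x‖)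
      (fun z hz => by
        refine (ContinuousLinearMap.le_opNorm _ _).trans ?_
        have := hM1 (a, z) ⟨ha, hz⟩
        rw [norm_iteratedFDeriv_one] at this
        gcongr)
  have hi2 : ∀ x y, IntegrableOn (fun z => fderiv ℝ (fderiv ℝ V) (a, z) x y) Ω := fun x y =>
    integrableOn_of_continuousOn_of_bounded hΩ.measurableSet hvol
      (((hc2.comp (hsc a) (hslice a ha)).clm_apply continuousOn_const).clm_apply
        continuousOn_const) (M := M2 * ‖x‖ * ‖y‖)
      (fun z hz => by
        refine (ContinuousLinearMap.le_opNorm₂ _ _ _).trans ?_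
        have := hM2 (a, z) ⟨ha, hz⟩
        rw [← norm_iteratedFDeriv_fderiv, norm_iteratedFDeriv_one] at this
        gcongr)
  refine ⟨hi1, hi2, |M3| * volume.real Ω, by positivity, ?_⟩
  intro w hw
  have haw : a + w ∈ U := haR (by simpa using hw)
  set L : (Fin n → ℂ) → ℝ := fun z => V (a, z)
    + (fderiv ℝ V (a, z) (1, 0) * w.re + fderiv ℝ V (a, z) (I, 0) * w.im)
    + (fderiv ℝ (fderiv ℝ V) (a, z) (1, 0) (1, 0) * w.re ^ 2
      + (fderiv ℝ (fderiv ℝ V) (a, z) (1, 0) (I, 0)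
        + fderiv ℝ (fderiv ℝ V) (a, z) (I, 0) (1, 0)) * w.re * w.im
      + fderiv ℝ (fderiv ℝ V) (a, z) (I, 0) (I, 0) * w.im ^ 2) / 2 + |M3| * ‖w‖ ^ 3 with hL
  have hpt : ∀ z ∈ Ω, V (a + w, z) ≤ L z := by
    intro z hz
    have hseg : segment ℝ ((a, z) : ℂ × (Fin n → ℂ)) ((a, z) + (w, 0)) ⊆ U ×ˢ Ω := by
      have hconv : Convex ℝ (Metric.ball a R ×ˢ ({z} : Set (Fin n → ℂ))) :=
        (convex_ball a R).prod (convex_singleton z)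
      refine (hconv.segment_subset ?_ ?_).trans (prod_mono haR (singleton_subset_iff.2 hz))
      · exact ⟨Metric.mem_ball_self hR, rfl⟩
      · exact ⟨by simpa using hw, by simp⟩
    have ht := (abs_le.1 (abs_taylor_two_remainder_le hS hV
      (fun p hp => (hM3 p hp).trans (le_abs_self M3)) hseg)).2
    have hwn : ‖((w, 0) : ℂ × (Fin n → ℂ))‖ = ‖w‖ := by simp [Prod.norm_def]
    have hdec : ((w, 0) : ℂ × (Fin n → ℂ)) = w.re • ((1, 0) : ℂ × (Fin n → ℂ))
        + w.im • ((I, 0) : ℂ × (Fin n → ℂ)) := by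
      ext1
      · apply Complex.ext <;> simp
      · simp
    have hsum : ((a, z) : ℂ × (Fin n → ℂ)) + (w, 0) = (a + w, z) := by simp
    rw [hwn, hsum, hdec] at ht
    simp only [map_add, map_smul, add_apply, smul_apply, smul_eq_mul] at ht
    simp only [hL]
    linarith
  have j1 := ((hi1 (1, 0)).mul_const w.re).add ((hi1 (I, 0)).mul_const w.im)
  have j0 := (hi0 a ha).add j1
  have jm := (hi2 (1, 0) (I, 0)).add (hi2 (I, 0) (1, 0))
  have jm' := (jm.mul_const w.re).mul_const w.im
  have ja := ((hi2 (1, 0) (1, 0)).mul_const (w.re ^ 2)).add jm'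
  have jq := (ja.add ((hi2 (I, 0) (I, 0)).mul_const (w.im ^ 2))).div_const 2
  have jc : IntegrableOn (fun _ : Fin n → ℂ => |M3| * ‖w‖ ^ 3) Ω := integrableOn_const hvol
  have hLi : IntegrableOn L Ω := (j0.add jq).add jc
  refine (setIntegral_mono_on (hi0 _ haw) hLi hΩ.measurableSet hpt).trans (le_of_eq ?_)
  have e1 := integral_add (j0.add jq) jc
  have e2 := integral_add j0 jq
  have e3 := integral_add (hi0 a ha) j1
  have e4 := integral_add ((hi1 (1, 0)).mul_const w.re) ((hi1 (I, 0)).mul_const w.im)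
  have e5 := integral_div (μ := volume.restrict Ω) 2 (fun z =>
    fderiv ℝ (fderiv ℝ V) (a, z) (1, 0) (1, 0) * w.re ^ 2
      + (fderiv ℝ (fderiv ℝ V) (a, z) (1, 0) (I, 0)
        + fderiv ℝ (fderiv ℝ V) (a, z) (I, 0) (1, 0)) * w.re * w.im
      + fderiv ℝ (fderiv ℝ V) (a, z) (I, 0) (I, 0) * w.im ^ 2)
  have e6 := integral_add ja ((hi2 (I, 0) (I, 0)).mul_const (w.im ^ 2))
  have e7 := integral_add ((hi2 (1, 0) (1, 0)).mul_const (w.re ^ 2)) jm'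
  have e8 := integral_add (hi2 (1, 0) (I, 0)) (hi2 (I, 0) (1, 0))
  simp only [Pi.add_apply, integral_mul_const, setIntegral_const,
    smul_eq_mul] at e1 e2 e3 e4 e5 e6 e7 e8
  rw [hL, e1, e2, e3, e4, e5, e6, e7, e8]
  ring

/-- Fubini for `|f(τ)|² V(τ, z)` over the product of a disc with `Ω`. -/
theorem setIntegral_ball_prod (hΩ : IsOpen Ω) (hvol : volume Ω ≠ ⊤)
    (hV : ContinuousOn V (U ×ˢ Ω)) {M : ℝ} (hM : ∀ p ∈ U ×ˢ Ω, ‖V p‖ ≤ M) {a : ℂ} {r : ℝ}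
    (har : Metric.ball a r ⊆ U) {f : ℂ → ℂ} (hf : Continuous f) :
    IntegrableOn (fun p : ℂ × (Fin n → ℂ) => ‖f p.1‖ ^ 2 * V p) (Metric.ball a r ×ˢ Ω) ∧
    IntegrableOn (fun w => ‖f w‖ ^ 2 * ∫ z in Ω, V (w, z)) (Metric.ball a r) ∧
    ∫ p in Metric.ball a r ×ˢ Ω, ‖f p.1‖ ^ 2 * V p
      = ∫ w in Metric.ball a r, ‖f w‖ ^ 2 * ∫ z in Ω, V (w, z) := by
  obtain ⟨K, hK⟩ := (isCompact_closedBall a r).exists_bound_of_continuousOn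
    (f := fun w => ‖f w‖ ^ 2) (by fun_prop)
  have hint : IntegrableOn (fun p : ℂ × (Fin n → ℂ) => ‖f p.1‖ ^ 2 * V p)
      (Metric.ball a r ×ˢ Ω) := by
    refine integrableOn_of_continuousOn_of_bounded (measurableSet_ball.prod hΩ.measurableSet) ?_
      ((by fun_prop : Continuous fun p : ℂ × (Fin n → ℂ) => ‖f p.1‖ ^ 2).continuousOn.mul
        (hV.mono (prod_mono har le_rfl))) (M := K * M) ?_
    · rw [Measure.volume_eq_prod, Measure.prod_prod]
      exact ENNReal.mul_ne_top measure_ball_lt_top.ne hvol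
    · rintro p ⟨h1, h2⟩
      rw [norm_mul]
      have k1 := hK p.1 (Metric.ball_subset_closedBall h1)
      exact mul_le_mul k1 (hM p ⟨har h1, h2⟩) (norm_nonneg _) ((norm_nonneg _).trans k1)
  have hint' : Integrable (fun p : ℂ × (Fin n → ℂ) => ‖f p.1‖ ^ 2 * V p)
      ((volume.restrict (Metric.ball a r)).prod (volume.restrict Ω)) := by
    rwa [Measure.prod_restrict, ← Measure.volume_eq_prod]
  refine ⟨hint, ?_, ?_⟩
  · have := hint'.integral_prod_left
    simp only [integral_const_mul] at this
    exact this
  · rw [Measure.volume_eq_prod, setIntegral_prod _ hint]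
    simp only [integral_const_mul]

/-- The mean value inequality for the fibre integral of functions superharmonic in `τ`. -/
theorem setIntegral_ball_fibreIntegral_le (hΩ : IsOpen Ω) (hvol : volume Ω ≠ ⊤)
    (hV : ContDiffOn ℝ 2 V (U ×ˢ Ω)) {M : ℝ} (hM : ∀ p ∈ U ×ˢ Ω, ‖V p‖ ≤ M)
    (hlap : ∀ τ ∈ U, ∀ z ∈ Ω, fderiv ℝ (fderiv ℝ fun s => V (s, z)) τ 1 1
      + fderiv ℝ (fderiv ℝ fun s => V (s, z)) τ I I ≤ 0) {a : ℂ} {r R : ℝ} (hr : 0 < r)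
    (hrR : r < R) (haR : Metric.ball a R ⊆ U) :
    ∫ w in Metric.ball a r, ∫ z in Ω, V (w, z) ≤ Real.pi * r ^ 2 * ∫ z in Ω, V (a, z) := by
  have har : Metric.ball a r ⊆ U := (Metric.ball_subset_ball hrR.le).trans haR
  have ha : a ∈ U := har (Metric.mem_ball_self hr)
  have hint := (setIntegral_ball_prod hΩ hvol hV.continuousOn hM har
    (continuous_const (y := (1 : ℂ)))).1
  have hint' : Integrable (Function.uncurry fun (w : ℂ) (z : Fin n → ℂ) => V (w, z))
      ((volume.restrict (Metric.ball a r)).prod (volume.restrict Ω)) := by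
    rw [Measure.prod_restrict, ← Measure.volume_eq_prod]
    simp only [norm_one, one_pow, one_mul] at hint
    exact hint
  rw [integral_integral_swap hint', ← integral_const_mul]
  refine setIntegral_mono_on hint'.integral_prod_right ?_ hΩ.measurableSet ?_
  · refine Integrable.const_mul ?_ _
    exact integrableOn_of_continuousOn_of_bounded hΩ.measurableSet hvol
      (hV.continuousOn.comp (f := fun z : Fin n → ℂ => (a, z)) (by fun_prop)
        (fun z hz => ⟨ha, hz⟩)) (fun z hz => hM (a, z) ⟨ha, hz⟩)
  · intro z hz
    refine setIntegral_ball_le (R := R) ?_ (fun p hp => hlap p (haR hp) z hz) hr hrR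
    exact hV.comp (f := fun s : ℂ => (s, z)) (by fun_prop) (fun s hs => ⟨haR hs, hz⟩)

end Fibre

theorem le_boundaryRadius {U : Set ℂ} (hUb : Bornology.IsBounded U) {a : ℂ} {R : ℝ}
    (hR : 0 < R) (haR : Metric.ball a R ⊆ U) : R ≤ boundaryRadius U a := by
  refine le_csSup ?_ ⟨hR, haR⟩
  obtain ⟨C, hC⟩ := hUb.subset_ball a
  refine ⟨C, ?_⟩
  rintro ρ ⟨hρ, hsub⟩
  by_contra! hlt
  have hC0 : 0 < C := dist_nonneg.trans_lt (hC (hsub (Metric.mem_ball_self hρ)))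
  have h1 : a + (C : ℂ) ∈ Metric.ball a ρ := by
    simp [abs_of_pos hC0, hlt]
  have h2 := hC (hsub h1)
  simp [abs_of_pos hC0] at h2

end SharperEstimate

end

theorem mainTheorem10 {n : ℕ} (U : Set ℂ) (Ω : Set (Fin n → ℂ))
    (hU : IsOpen U) (hUc : IsConnected U) (hUb : Bornology.IsBounded U)
    (hΩ : IsOpen Ω) (hΩc : IsConnected Ω) (hΩb : Bornology.IsBounded Ω)
    (φ : ℂ × (Fin n → ℂ) → ℝ)
    (hφ : ContDiffOn ℝ ∞ φ (closure (U ×ˢ Ω)))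
    (hpsh : SharperEstimate.PlurisubharmonicOn φ (U ×ˢ Ω))
    (g : ℂ → ℝ) (hg : ∀ τ ∈ U, 0 ≤ g τ)
    (hcurv : ∀ τ ∈ U, ∀ z ∈ Ω,
      g τ ≤ SharperEstimate.dTauTauBar φ τ z - ‖SharperEstimate.dTau φ τ z‖ ^ 2) :
    ∀ a ∈ U, ∀ ε : ℝ, 0 < ε →
      ∃ rε : ℝ, 0 < rε ∧ rε < SharperEstimate.boundaryRadius U a ∧
        ∀ r : ℝ, 0 < r → r < rε →
          SharperEstimate.extensionIndex (SharperEstimate.fiberPotential φ Ω) a r ≤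
              ENNReal.ofReal (Real.exp
                (-(max ((SharperEstimate.curvatureBound φ Ω g a - ε) / 2) 0) * r ^ 2)) ∧
            ∃ f : ℂ → ℂ, DifferentiableOn ℂ f (Metric.ball a r) ∧ f a = 1 ∧
              IntegrableOn (fun p : ℂ × (Fin n → ℂ) => ‖f p.1‖ ^ 2 * Real.exp (-φ p))
                (Metric.ball a r ×ˢ Ω) ∧
              ∫ p in Metric.ball a r ×ˢ Ω, ‖f p.1‖ ^ 2 * Real.exp (-φ p) ≤
                Real.exp (-(max ((SharperEstimate.curvatureBound φ Ω g a - ε) / 2) 0) * r ^ 2) *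
                  (Real.pi * r ^ 2) * ∫ z in Ω, Real.exp (-φ (a, z)) := by
  intro a ha ε hε
  set V : ℂ × (Fin n → ℂ) → ℝ := fun p => Real.exp (-φ p) with hVdef
  have hS : IsOpen (U ×ˢ Ω) := hU.prod hΩ
  have hcpt : IsCompact (closure (U ×ˢ Ω)) := (hUb.prod hΩb).isCompact_closure
  have hVc : ContDiffOn ℝ ∞ V (closure (U ×ˢ Ω)) := hφ.neg.exp
  have hb : ∀ k ≤ 3, ∃ M : ℝ, ∀ p ∈ U ×ˢ Ω, ‖iteratedFDeriv ℝ k V p‖ ≤ M := fun k _ =>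
    SharperEstimate.exists_bound_norm_iteratedFDeriv hS hcpt
      (contDiffOn_infty.1 hVc k)
  have hVS : ContDiffOn ℝ 3 V (U ×ˢ Ω) :=
    (by exact_mod_cast contDiffOn_infty.1 hVc 3 : ContDiffOn ℝ 3 V _).mono subset_closure
  have hφS : ContDiffOn ℝ 2 φ (U ×ˢ Ω) :=
    (by exact_mod_cast contDiffOn_infty.1 hφ 2 : ContDiffOn ℝ 2 φ _).mono subset_closure
  obtain ⟨M₀, hM₀⟩ : ∃ M : ℝ, ∀ p ∈ U ×ˢ Ω, ‖V p‖ ≤ M := by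
    obtain ⟨M, hM⟩ := hb 0 (by norm_num)
    exact ⟨M, fun p hp => by simpa using hM p hp⟩
  have hvol : volume Ω ≠ ⊤ := hΩb.measure_lt_top.ne
  have hslice : ∀ τ ∈ U, ∀ z ∈ Ω, ContDiffAt ℝ 2 (fun s => φ (s, z)) τ := fun τ hτ z hz =>
    (hφS.contDiffAt (hS.mem_nhds ⟨hτ, hz⟩)).comp τ (f := fun s : ℂ => (s, z)) (by fun_prop)
  have hlap : ∀ τ ∈ U, ∀ z ∈ Ω, fderiv ℝ (fderiv ℝ fun s => V (s, z)) τ 1 1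
      + fderiv ℝ (fderiv ℝ fun s => V (s, z)) τ I I ≤ -4 * g τ * V (τ, z) := by
    intro τ hτ z hz
    have h1 := SharperEstimate.laplacian_exp_neg (hslice τ hτ z hz)
    have h2 := hcurv τ hτ z hz
    rw [SharperEstimate.dTauTauBar, SharperEstimate.dTau] at h2
    have h3 := mul_le_mul_of_nonneg_left h2 (Real.exp_pos (-φ (τ, z))).le
    simp only [hVdef]
    rw [h1]
    linarith
  have hVint : ∀ τ ∈ U, IntegrableOn (fun z => V (τ, z)) Ω := fun τ hτ =>
    SharperEstimate.integrableOn_of_continuousOn_of_bounded hΩ.measurableSet hvol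
      (hVS.continuousOn.comp (f := fun z : Fin n → ℂ => (τ, z)) (by fun_prop)
        (fun z hz => ⟨hτ, hz⟩)) (fun z hz => hM₀ (τ, z) ⟨hτ, hz⟩)
  set F : ℂ → ℝ := fun τ => ∫ z in Ω, V (τ, z) with hFdef
  have hFpos : ∀ τ ∈ U, 0 < F τ := by
    intro τ hτ
    have : NeZero (volume.restrict Ω) :=
      ⟨by simpa [Measure.restrict_eq_zero] using (hΩ.measure_pos volume hΩc.nonempty).ne'⟩
    exact integral_exp_pos (hVint τ hτ)
  have hexp : ∀ τ ∈ U, Real.exp (-SharperEstimate.fiberPotential φ Ω τ) = F τ := by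
    intro τ hτ
    rw [SharperEstimate.fiberPotential, neg_neg]
    exact Real.exp_log (hFpos τ hτ)
  obtain ⟨R, hR, haR⟩ := Metric.isOpen_iff.1 hU a ha
  have hRδ := SharperEstimate.le_boundaryRadius hUb hR haR
  -- both conclusions follow from a bound for the integral of `|f|² F` over the disc
  have hfinish : ∀ r : ℝ, 0 < r → r < R → ∀ c : ℝ, 0 < c → ∀ f : ℂ → ℂ, Differentiable ℂ f →
      f a = 1 → (∫ w in Metric.ball a r, ‖f w‖ ^ 2 * F w ≤ c * (Real.pi * r ^ 2) * F a) →
      SharperEstimate.extensionIndex (SharperEstimate.fiberPotential φ Ω) a r ≤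
          ENNReal.ofReal c ∧
        ∃ f : ℂ → ℂ, DifferentiableOn ℂ f (Metric.ball a r) ∧ f a = 1 ∧
          IntegrableOn (fun p : ℂ × (Fin n → ℂ) => ‖f p.1‖ ^ 2 * Real.exp (-φ p))
            (Metric.ball a r ×ˢ Ω) ∧
          ∫ p in Metric.ball a r ×ˢ Ω, ‖f p.1‖ ^ 2 * Real.exp (-φ p) ≤
            c * (Real.pi * r ^ 2) * ∫ z in Ω, Real.exp (-φ (a, z)) := by
    intro r hr hrR c hc f hf hfa hle
    have har : Metric.ball a r ⊆ U := (Metric.ball_subset_ball hrR.le).trans haR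
    obtain ⟨i1, i2, i3⟩ := SharperEstimate.setIntegral_ball_prod hΩ hvol hVS.continuousOn hM₀ har
      hf.continuous
    have heq : EqOn (fun w => ‖f w‖ ^ 2 * F w)
        (fun w => ‖f w‖ ^ 2 * Real.exp (-SharperEstimate.fiberPotential φ Ω w))
        (Metric.ball a r) := fun w hw => by
      simp only [hexp w (har hw)]
    refine ⟨SharperEstimate.extensionIndex_le hr hc hf.differentiableOn hfa
      (i2.congr_fun heq measurableSet_ball) ?_, f, hf.differentiableOn, hfa, i1, i3.trans_le hle⟩
    rw [← setIntegral_congr_fun measurableSet_ball heq, hexp a ha]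
    exact hle
  rcases le_or_gt (SharperEstimate.curvatureBound φ Ω g a - ε) 0 with hG | hG
  · -- `F` is superharmonic, so the constant function `1` is good enough
    refine ⟨R / 2, by linarith, by linarith, fun r hr hrε => ?_⟩
    rw [max_eq_right (by linarith)]
    refine hfinish r hr (by linarith) _ (Real.exp_pos _) (fun _ => 1) (differentiable_const _)
      rfl ?_
    have := SharperEstimate.setIntegral_ball_fibreIntegral_le hΩ hvol
      (hVS.of_le (by norm_num)) hM₀ (fun τ hτ z hz => (hlap τ hτ z hz).trans (by
        have := mul_nonneg (hg τ hτ) (Real.exp_pos (-φ (τ, z))).le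
        simp only [hVdef]
        linarith)) hr (by linarith : r < R) haR
    simpa using this
  · -- `f = 1 + α(τ - a)` with `α = -F_τ(a) / F(a)` cancels the linear term of `|f|² F`
    obtain ⟨j1, j2, M, hM, hT⟩ := SharperEstimate.fibreIntegral_taylor_le hU hΩ hvol hVS hb hR haR
    set P := ∫ z in Ω, fderiv ℝ V (a, z) (1, 0) with hP
    set Q := ∫ z in Ω, fderiv ℝ V (a, z) (I, 0) with hQ
    set A := ∫ z in Ω, fderiv ℝ (fderiv ℝ V) (a, z) (1, 0) (1, 0) with hA
    set C := ∫ z in Ω, fderiv ℝ (fderiv ℝ V) (a, z) (I, 0) (I, 0) with hC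
    -- `T = -F_τ(a)`, and `|T / F(a)|²` is the second term of `G(a)`
    set T := ∫ z in Ω, SharperEstimate.dTau φ a z * (Real.exp (-φ (a, z)) : ℂ) with hTdef
    have hF0 : 0 < F a := hFpos a ha
    have hTPQ : T = ((-P / 2 : ℝ) : ℂ) + ((Q / 2 : ℝ) : ℂ) * I := by
      have hpt : ∀ z ∈ Ω, SharperEstimate.dTau φ a z * (Real.exp (-φ (a, z)) : ℂ)
          = ((-fderiv ℝ V (a, z) (1, 0) / 2 : ℝ) : ℂ)
            + ((fderiv ℝ V (a, z) (I, 0) / 2 : ℝ) : ℂ) * I := by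
        intro z hz
        have hd := (hslice a ha z hz).differentiableAt (by norm_num)
        have hdV : DifferentiableAt ℝ V (a, z) :=
          (hVS.contDiffAt (hS.mem_nhds ⟨ha, hz⟩)).differentiableAt (by norm_num)
        have e : ∀ x : ℂ, fderiv ℝ V (a, z) (x, 0)
            = -(Real.exp (-φ (a, z)) * fderiv ℝ (fun s => φ (s, z)) a x) := by
          intro x
          have h1 := congrArg (fun l => l x) (SharperEstimate.fderiv_slice hdV)
          have h2 := congrArg (fun l => l x) (SharperEstimate.fderiv_exp_neg hd)
          simp only [ContinuousLinearMap.comp_apply, ContinuousLinearMap.inl_apply] at h1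
          rw [← h1]
          exact h2
        rw [SharperEstimate.dTau, SharperEstimate.dW_ofReal hd, e, e]
        push_cast
        ring
      have k1 : IntegrableOn (fun z => ((-fderiv ℝ V (a, z) (1, 0) / 2 : ℝ) : ℂ)) Ω :=
        ((j1 (1, 0)).neg.div_const 2).ofReal
      have k2 : IntegrableOn (fun z => ((fderiv ℝ V (a, z) (I, 0) / 2 : ℝ) : ℂ)) Ω :=
        ((j1 (I, 0)).div_const 2).ofReal
      rw [hTdef, setIntegral_congr_fun hΩ.measurableSet hpt, integral_add k1 (k2.mul_const I),
        integral_mul_const, integral_complex_ofReal, integral_complex_ofReal, integral_div,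
        integral_div, integral_neg]
    set α : ℂ := T / (F a : ℂ) with hα
    have hαn : SharperEstimate.curvatureBound φ Ω g a = g a + ‖α‖ ^ 2 := by
      rw [hα, norm_div, div_pow, Complex.norm_real, Real.norm_of_nonneg hF0.le]
      rfl
    have hlin : ∀ w : ℂ, P * w.re + Q * w.im = -(2 * F a * (α * w).re) := by
      intro w
      have h1 : (F a : ℂ) * α = T := by
        rw [hα]; field_simp [Complex.ofReal_ne_zero.2 hF0.ne']
      have h2 : F a * (α * w).re = (T * w).re := by
        rw [← h1, mul_assoc, Complex.re_ofReal_mul]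
      rw [mul_assoc, h2, hTPQ]
      simp
      ring
    -- `A + C` is the Laplacian of `F` at `a`
    have hAC : A + C ≤ -4 * g a * F a := by
      rw [hA, hC, ← integral_add (j2 _ _) (j2 _ _), hFdef, ← integral_const_mul]
      refine setIntegral_mono_on ((j2 _ _).add (j2 _ _)) ((hVint a ha).const_mul _)
        hΩ.measurableSet fun z hz => ?_
      have hcd : ContDiffAt ℝ 2 V (a, z) :=
        (hVS.of_le (by norm_num)).contDiffAt (hS.mem_nhds ⟨ha, hz⟩)
      rw [← SharperEstimate.fderiv_fderiv_slice hcd, ← SharperEstimate.fderiv_fderiv_slice hcd]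
      exact hlap a ha z hz
    set K := (1 + ‖α‖) ^ 2 * M with hK
    have hK0 : 0 ≤ K := by positivity
    -- the cubic error `K r³` has to be absorbed by `F(a) ε r² / 2`
    refine ⟨min (R / 2) (min 1 (F a * ε / (2 * (K + 1)))), by positivity,
      (min_le_left _ _).trans_lt (by linarith), fun r hr hrε => ?_⟩
    have hr1 : r < R := (hrε.trans_le (min_le_left _ _)).trans (by linarith)
    have hr2 : r < 1 := hrε.trans_le ((min_le_right _ _).trans (min_le_left _ _))
    have hr3 : r < F a * ε / (2 * (K + 1)) :=
      hrε.trans_le ((min_le_right _ _).trans (min_le_right _ _))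
    rw [max_eq_left (by linarith)]
    set G := SharperEstimate.curvatureBound φ Ω g a with hGdef
    have har : Metric.ball a r ⊆ U := (Metric.ball_subset_ball hr1.le).trans haR
    have hfd : Differentiable ℂ fun w : ℂ => 1 + α * (w - a) := by fun_prop
    refine hfinish r hr hr1 _ (Real.exp_pos _) (fun w => 1 + α * (w - a)) hfd (by simp) ?_
    have hi := (SharperEstimate.setIntegral_ball_prod hΩ hvol hVS.continuousOn hM₀ har
      hfd.continuous).2.1
    refine (SharperEstimate.setIntegral_ball_mul_le
      (B := (∫ z in Ω, fderiv ℝ (fderiv ℝ V) (a, z) (1, 0) (I, 0))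
        + ∫ z in Ω, fderiv ℝ (fderiv ℝ V) (a, z) (I, 0) (1, 0))
      hF0 hM (hg a ha) hAC (fun w hw => ?_) hr hr1 hr2.le hi).trans ?_
    · have := hT w hw
      rw [hlin w] at this
      linarith
    · rw [← hαn]
      have h1 := Real.add_one_le_exp (-((G - ε) / 2) * r ^ 2)
      have h2 : K * r ≤ F a * ε / 2 := by
        rw [lt_div_iff₀ (by positivity)] at hr3
        nlinarith
      have h3 : F a * (1 - G / 2 * r ^ 2) + K * r ^ 3
          ≤ F a * Real.exp (-((G - ε) / 2) * r ^ 2) := by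
        have h4 := mul_le_mul_of_nonneg_left h1 hF0.le
        have h5 := mul_le_mul_of_nonneg_right h2 (sq_nonneg r)
        nlinarith
      have h6 := mul_le_mul_of_nonneg_right h3 (by positivity : 0 ≤ Real.pi * r ^ 2)
      linarith
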